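/- Let $k\ge 1$ and let $X_1,X_2,X_3$ be independent and uniformly distributed on $\{0,1\}^k$; let $\Sigma=X_1+X_2+X_3\in\{0,1,2,3\}^k$ be their component-wise sum over the integers. Let $\mathcal Z$ be a finite alphabet with $|\mathcal Z|>1$. A variable-length $(k,N)$ network code over $\mathcal Z$ consists of encoders $\phi_1,\phi_2:\{0,1\}^k\times\{0,1\}^k\to\mathcal Z^\ast$, giving the words $Z_1=\phi_1(X_1,X_3)$ and $Z_2=\phi_2(X_2,X_3)$, of a stopping time $N$ for the sequence of pairs $(Z_1(1),Z_2(1)),(Z_1(2),Z_2(2)),\dots$ (that is, $N$ is at most the length of either word, and for every $n$ the indicator of $\{N=n\}$ is a function of the first $n$ pairs), and of a decoder $\psi$ that maps pairs of words of equal length to $\{0,1,2,3\}^k$. Write $Z_j^N$ for the first $N$ symbols of $Z_j$. The code is zero-error if $\Pr(\psi(Z_1^N,Z_2^N)\ne\Sigma)=0$. Logarithms are to base $2$ and entropies are in bits. Then there is a $K$ such that for all $k\ge K$, all such alphabets $\mathcal Z$ and all zero-error $(k,N)$ network codes over $\mathcal Z$, $$H(Z_1^N,Z_2^N\mid\Sigma)\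 \ge\ 0.75\,(\log 3-1)\,k .$$ In particular, for every $\mathcal Z$ and every sequence of zero-error codes over $\mathcal Z$, one for each $k$, $$\liminf_{k\to\infty}\frac{H(Z_1^N,Z_2^N\mid\Sigma)}{k}\ \ge\ 0.75\,(\log 3-1).$$ -/

import Mathlib

namespace ArithSum

open Classical in
/-- Probability of the event `E` under the uniform distribution on the finite sample space `Ω`. -/
noncomputable def pr {Ω : Type*} [Fintype Ω] (E : Ω → Prop) : ℝ :=
  ((Finset.univ.filter E).card : ℝ) / (Fintype.card Ω : ℝ)

/-- Conditional probability `Pr(U = u | V = v)`. -/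
noncomputable def condPr {Ω α β : Type*} [Fintype Ω] (U : Ω → α) (V : Ω → β) (u : α) (v : β) : ℝ :=
  pr (fun ω => U ω = u ∧ V ω = v) / pr (fun ω => V ω = v)

open Classical in
/-- Shannon entropy `H(U | V = v)` in bits; the sum is over the finitely many values of `U`. -/
noncomputable def entropyGiven {Ω α β : Type*} [Fintype Ω] (U : Ω → α) (V : Ω → β) (v : β) : ℝ :=
  ∑ u ∈ Finset.univ.image U, -(condPr U V u v * Real.logb 2 (condPr U V u v))

open Classical in
/-- Conditional Shannon entropy `H(U | V) = ∑ᵥ Pr(V = v) H(U | V = v)` in bits. -/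
noncomputable def condEntropy {Ω α β : Type*} [Fintype Ω] (U : Ω → α) (V : Ω → β) : ℝ :=
  ∑ v ∈ Finset.univ.image V, pr (fun ω => V ω = v) * entropyGiven U V v

/-- Blocks of `k` source bits. -/
abbrev Bits (k : ℕ) : Type := Fin k → Fin 2

/-- Realizations `(x₁, x₂, x₃)` of the three source blocks. With the uniform distribution on this
space, the `3k` source bits are independent and Bernoulli(1/2). -/
abbrev Inputs (k : ℕ) : Type := Bits k × Bits k × Bits k

/-- The component-wise arithmetic sum `x₁ + x₂ + x₃ ∈ {0,1,2,3}ᵏ`. -/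
def sum {k : ℕ} (ω : Inputs k) : Fin k → Fin 4 := fun i =>
  ⟨(ω.1 i).val + (ω.2.1 i).val + (ω.2.2 i).val, by
    have h₁ := (ω.1 i).isLt
    have h₂ := (ω.2.1 i).isLt
    have h₃ := (ω.2.2 i).isLt
    omega⟩

/-- A variable-length `(k, N)` network code over the alphabet `𝒵`: node `s₁` sees `(x₁, x₃)`,
node `s₂` sees `(x₂, x₃)`, each sends a finite word to the terminal, and the terminal stops after
receiving `N` symbols on each of its two edges. -/
structure NetworkCode (k : ℕ) (𝒵 : Type*) where
  /-- encoder on the edge `(s₁, t)` -/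
  enc₁ : Bits k → Bits k → List 𝒵
  /-- encoder on the edge `(s₂, t)` -/
  enc₂ : Bits k → Bits k → List 𝒵
  /-- the stopping time, a random variable -/
  N : Inputs k → ℕ
  /-- the first `N` symbols are present on both edges -/
  N_le₁ : ∀ ω : Inputs k, N ω ≤ (enc₁ ω.1 ω.2.2).length
  N_le₂ : ∀ ω : Inputs k, N ω ≤ (enc₂ ω.2.1 ω.2.2).length
  /-- the indicator of `{N = n}` is a function of the first `n` pairs of symbols -/
  stopping : ∀ (n : ℕ) (ω ω' : Inputs k),
    (enc₁ ω.1 ω.2.2).take n = (enc₁ ω'.1 ω'.2.2).take n →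
    (enc₂ ω.2.1 ω.2.2).take n = (enc₂ ω'.2.1 ω'.2.2).take n →
    (N ω = n ↔ N ω' = n)
  /-- decoder of the terminal; only its values on pairs of words of equal length matter -/
  dec : List 𝒵 → List 𝒵 → Fin k → Fin 4

namespace NetworkCode

variable {k : ℕ} {𝒵 : Type*}

/-- The stopped sequence `Z₁^N`. -/
def stopped₁ (C : NetworkCode k 𝒵) (ω : Inputs k) : List 𝒵 :=
  (C.enc₁ ω.1 ω.2.2).take (C.N ω)

/-- The stopped sequence `Z₂^N`. -/
def stopped₂ (C : NetworkCode k 𝒵) (ω : Inputs k) : List 𝒵 :=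
  (C.enc₂ ω.2.1 ω.2.2).take (C.N ω)

/-- The code recovers the sum with zero error: `Pr(ψ(Z₁^N, Z₂^N) ≠ Σ) = 0`. -/
def ZeroError (C : NetworkCode k 𝒵) : Prop :=
  pr (fun ω : Inputs k => C.dec (C.stopped₁ ω) (C.stopped₂ ω) ≠ sum ω) = 0

/-- `H(Z₁^N, Z₂^N | Σ)` in bits. -/
noncomputable def descriptionEntropy (C : NetworkCode k 𝒵) : ℝ :=
  condEntropy (fun ω : Inputs k => (C.stopped₁ ω, C.stopped₂ ω)) (fun ω => sum ω)

end NetworkCode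

end ArithSum

/-!
The terminal sees only prefixes of `enc₁ x₁ x₃` and `enc₂ x₂ x₃`, and the stopping rule depends only
on these prefixes. Hence, for fixed `x₃`, the inputs `(x₁, x₂)` that lead to a given stopped pair form
a rectangle. A zero-error decoder makes `x₁ + x₂` constant on that rectangle, so the rectangle has at
most one point: the stopped pair together with `x₃` determines the input
(`NetworkCode.stopped_injective_of_side`).

Fix a value `v` of the sum and let `w` be the number of coordinates where `v` is `1` or `2`. Given
`v`, the input is uniform on `3 ^ w` triples (`card_sum_fiber`), while `x₃` is free in at most the
`w` mixed coordinates. So at most `2 ^ w` of these triples share a stopped pair, each stopped pair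
has conditional probability at most `(2 / 3) ^ w`, and the conditional entropy given `v` is at least
`w (log 3 - 1)` (`NetworkCode.le_entropyGiven_stopped`). The mean of `w` is `3 k / 4`, which gives the
bound for every `k`.
-/

namespace ArithSum

/-! ### Conditional entropy under the uniform distribution -/

lemma pr_eq_card_div {Ω : Type*} [Fintype Ω] (E : Ω → Prop) [DecidablePred E] :
    pr E = ((Finset.univ.filter E).card : ℝ) / (Fintype.card Ω : ℝ) := by
  unfold pr
  congr!

lemma condPr_eq_card_div {Ω α β : Type*} [Fintype Ω] [DecidableEq α] [DecidableEq β]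
    (U : Ω → α) (V : Ω → β) (u : α) (v : β) :
    condPr U V u v = ((Finset.univ.filter fun ω => U ω = u ∧ V ω = v).card : ℝ) /
      ((Finset.univ.filter fun ω => V ω = v).card : ℝ) := by
  rw [condPr, pr_eq_card_div, pr_eq_card_div]
  rcases isEmpty_or_nonempty Ω with h | h
  · simp
  · exact div_div_div_cancel_right₀ (by positivity) _ _

lemma sum_condPr_eq_one {Ω α β : Type*} [Fintype Ω] [DecidableEq α] [DecidableEq β]
    (U : Ω → α) (V : Ω → β) {v : β} (hv : ∃ ω, V ω = v) :
    ∑ u ∈ Finset.univ.image U, condPr U V u v = 1 := by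
  have hpos : (0 : ℝ) < ((Finset.univ.filter fun ω => V ω = v).card : ℝ) := by
    obtain ⟨ω, hω⟩ := hv
    exact_mod_cast Finset.card_pos.2 ⟨ω, by simpa using hω⟩
  simp_rw [condPr_eq_card_div, ← Finset.sum_div]
  rw [div_eq_one_iff_eq hpos.ne', ← Nat.cast_sum]
  congr 1
  rw [Finset.card_eq_sum_card_fiberwise (f := U) (t := Finset.univ.image U)
    fun ω _ => Finset.mem_coe.2 (Finset.mem_image_of_mem U (Finset.mem_univ ω))]
  simp_rw [Finset.filter_filter, and_comm]

/-- If every value of `U` has conditional probability at most `q` given `V = v`, then the entropy of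
`U` given `V = v` is at least the min-entropy bound `-log q`. -/
lemma neg_logb_le_entropyGiven {Ω α β : Type*} [Fintype Ω] (U : Ω → α) (V : Ω → β) {v : β}
    (hv : ∃ ω, V ω = v) {q : ℝ} (hq : ∀ u, condPr U V u v ≤ q) :
    -Real.logb 2 q ≤ entropyGiven U V v := by
  classical
  have hnn : ∀ u, 0 ≤ condPr U V u v := fun u => by
    rw [condPr_eq_card_div]; positivity
  have hsum : -Real.logb 2 q
      = ∑ u ∈ Finset.univ.image U, condPr U V u v * -Real.logb 2 q := by
    rw [← Finset.sum_mul, sum_condPr_eq_one U V hv, one_mul]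
  rw [hsum]
  unfold entropyGiven
  have key : ∀ u, condPr U V u v * -Real.logb 2 q
      ≤ -(condPr U V u v * Real.logb 2 (condPr U V u v)) := fun u => by
    rcases (hnn u).eq_or_lt with h | h
    · simp [← h]
    · rw [← mul_neg]
      exact mul_le_mul_of_nonneg_left
        (neg_le_neg (Real.logb_le_logb_of_le one_lt_two h (hq u))) h.le
  convert Finset.sum_le_sum fun u _ => key u

/-- The expectation of a function of `V`, summed over values of `V` or over sample points. -/
lemma sum_pr_mul_eq {Ω β : Type*} [Fintype Ω] [DecidableEq β] (V : Ω → β) (f : β → ℝ) :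
    ∑ v ∈ Finset.univ.image V, pr (fun ω => V ω = v) * f v
      = (∑ ω, f (V ω)) / (Fintype.card Ω : ℝ) := by
  rw [← Finset.sum_fiberwise_of_maps_to (g := V) (t := Finset.univ.image V)
    (fun ω _ => Finset.mem_image_of_mem V (Finset.mem_univ ω)), Finset.sum_div]
  refine Finset.sum_congr rfl fun v _ => ?_
  have h : ∑ ω ∈ Finset.univ.filter (fun ω => V ω = v), f (V ω)
      = ∑ ω ∈ Finset.univ.filter (fun ω => V ω = v), f v :=
    Finset.sum_congr rfl fun ω hω => by rw [(Finset.mem_filter.1 hω).2]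
  rw [h, Finset.sum_const, nsmul_eq_mul, pr_eq_card_div]
  ring

/-! ### Fibres of the component-wise sum -/

/-- The arithmetic sum of three bits. -/
def bitSum (t : Fin 2 × Fin 2 × Fin 2) : Fin 4 :=
  ⟨t.1.val + t.2.1.val + t.2.2.val, by omega⟩

/-- Three blocks of `k` bits, read as `k` triples of bits. -/
def inputsEquiv (k : ℕ) : Inputs k ≃ (Fin k → Fin 2 × Fin 2 × Fin 2) where
  toFun ω i := (ω.1 i, ω.2.1 i, ω.2.2 i)
  invFun f := (fun i => (f i).1, fun i => (f i).2.1, fun i => (f i).2.2)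
  left_inv _ := rfl
  right_inv _ := rfl

/-- The mixed coordinates of `v`: those where the three summed bits are not all equal. -/
def mixed {k : ℕ} (v : Fin k → Fin 4) : Finset (Fin k) :=
  Finset.univ.filter fun i => v i = 1 ∨ v i = 2

lemma prod_ite_mixed {k : ℕ} (v : Fin k → Fin 4) (a : ℕ) :
    ∏ i, (if v i = 1 ∨ v i = 2 then a else 1) = a ^ (mixed v).card := by
  rw [Finset.prod_ite, Finset.prod_const, Finset.prod_const_one, mul_one, mixed]

lemma card_sum_fiber {k : ℕ} (v : Fin k → Fin 4) :
    (Finset.univ.filter fun ω : Inputs k => sum ω = v).card = 3 ^ (mixed v).card := by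
  have hbit : ∀ s : Fin 4, (Finset.univ.filter fun t => bitSum t = s).card
      = if s = 1 ∨ s = 2 then 3 else 1 := by decide
  rw [← prod_ite_mixed, ← Finset.prod_congr rfl fun i _ => hbit (v i), ← Fintype.card_piFinset]
  refine Finset.card_equiv (inputsEquiv k) fun ω => ?_
  simp only [Finset.mem_filter, Finset.mem_univ, true_and, Fintype.mem_piFinset, funext_iff]
  rfl

/-- Given the sum, the third block can vary in the mixed coordinates only. -/
lemma card_le_two_pow_of_injOn {k : ℕ} (v : Fin k → Fin 4) (S : Finset (Inputs k))
    (hS : ∀ ω ∈ S, sum ω = v) (hinj : Set.InjOn (fun ω : Inputs k => ω.2.2) S) :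
    S.card ≤ 2 ^ (mixed v).card := by
  have hbit : ∀ s : Fin 4, ((Finset.univ.filter fun t => bitSum t = s).image fun t => t.2.2).card
      = if s = 1 ∨ s = 2 then 2 else 1 := by decide
  rw [← prod_ite_mixed, ← Finset.prod_congr rfl fun i _ => hbit (v i), ← Fintype.card_piFinset]
  refine Finset.card_le_card_of_injOn (fun ω => ω.2.2) (fun ω hω => ?_) hinj
  refine Finset.mem_coe.2 (Fintype.mem_piFinset.2 fun i => Finset.mem_image.2
    ⟨inputsEquiv k ω i, ?_, rfl⟩)
  rw [Finset.mem_filter]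
  exact ⟨Finset.mem_univ _, congrFun (hS ω hω) i⟩

/-- Six of the eight values of three bits have sum `1` or `2`. -/
lemma sum_card_mixed (k : ℕ) :
    (∑ ω : Inputs k, ((mixed (sum ω)).card : ℝ)) / (Fintype.card (Inputs k) : ℝ)
      = 0.75 * (k : ℝ) := by
  have hcoord : ∀ i : Fin k,
      4 * (∑ ω : Inputs k, if sum ω i = 1 ∨ sum ω i = 2 then 1 else 0)
        = 3 * Fintype.card (Inputs k) := fun i => by
    have h1 : (∑ ω : Inputs k, if sum ω i = 1 ∨ sum ω i = 2 then 1 else 0)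
        = ∑ f : Fin k → Fin 2 × Fin 2 × Fin 2,
            if bitSum (f i) = 1 ∨ bitSum (f i) = 2 then 1 else 0 :=
      Fintype.sum_equiv (inputsEquiv k) _ _ fun ω => rfl
    have h2 := Fintype.sum_piFinset_apply
      (fun t : Fin 2 × Fin 2 × Fin 2 => if bitSum t = 1 ∨ bitSum t = 2 then 1 else 0)
      Finset.univ i
    rw [Fintype.piFinset_univ] at h2
    have h3 : (∑ t : Fin 2 × Fin 2 × Fin 2,
      if bitSum t = 1 ∨ bitSum t = 2 then 1 else 0) = 6 := by decide
    obtain ⟨m, rfl⟩ : ∃ m, k = m + 1 := ⟨k - 1, by have := i.isLt; omega⟩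
    rw [h1, h2, h3, Fintype.card_congr (inputsEquiv (m + 1))]
    simp only [Finset.card_univ, Fintype.card_prod, Fintype.card_fin, Fintype.card_fun, smul_eq_mul,
      Nat.add_sub_cancel, pow_succ]
    ring
  have htotal : 4 * ∑ ω : Inputs k, (mixed (sum ω)).card = k * (3 * Fintype.card (Inputs k)) := by
    simp_rw [mixed, Finset.card_filter]
    rw [Finset.sum_comm, Finset.mul_sum, Finset.sum_congr rfl fun i _ => hcoord i]
    simp
  have hpos : (0 : ℝ) < Fintype.card (Inputs k) := by exact_mod_cast Fintype.card_pos
  have htotal' : (4 : ℝ) * ∑ ω : Inputs k, ((mixed (sum ω)).card : ℝ)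
      = k * (3 * Fintype.card (Inputs k)) := by exact_mod_cast htotal
  rw [div_eq_iff hpos.ne']
  linarith

/-! ### Zero-error codes -/

namespace NetworkCode

variable {k : ℕ} {𝒵 : Type*}

lemma ZeroError.dec_eq {C : NetworkCode k 𝒵} (hC : C.ZeroError) (ω : Inputs k) :
    C.dec (C.stopped₁ ω) (C.stopped₂ ω) = sum ω := by
  classical
  rw [ZeroError, pr_eq_card_div, div_eq_zero_iff] at hC
  rcases hC with h | h
  · by_contra hne
    exact Finset.filter_eq_empty_iff.1 (Finset.card_eq_zero.1 (Nat.cast_eq_zero.1 h))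
      (Finset.mem_univ ω) hne
  · exact absurd h (by exact_mod_cast Fintype.card_ne_zero)

/-- For a fixed third block, the inputs with a given stopped pair form a rectangle. -/
lemma stopped_rectangle (C : NetworkCode k 𝒵) {x₁ x₂ y₁ y₂ x₃ : Bits k}
    (h₁ : C.stopped₁ (x₁, x₂, x₃) = C.stopped₁ (y₁, y₂, x₃))
    (h₂ : C.stopped₂ (x₁, x₂, x₃) = C.stopped₂ (y₁, y₂, x₃)) :
    C.stopped₁ (x₁, y₂, x₃) = C.stopped₁ (x₁, x₂, x₃) ∧
      C.stopped₂ (x₁, y₂, x₃) = C.stopped₂ (x₁, x₂, x₃) := by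
  have hN : C.N (x₁, x₂, x₃) = C.N (y₁, y₂, x₃) := by
    have h := congrArg List.length h₁
    simp only [stopped₁, List.length_take] at h
    rwa [min_eq_left (C.N_le₁ (x₁, x₂, x₃)), min_eq_left (C.N_le₁ (y₁, y₂, x₃))] at h
  simp only [stopped₂, ← hN] at h₂
  have hN' : C.N (x₁, y₂, x₃) = C.N (x₁, x₂, x₃) :=
    (C.stopping _ (x₁, x₂, x₃) (x₁, y₂, x₃) rfl h₂).1 rfl
  simp only [stopped₁, stopped₂, hN', h₂, and_self]

/-- In a zero-error code the stopped pair and the third block determine the input. -/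
lemma stopped_injective_of_side {C : NetworkCode k 𝒵} (hC : C.ZeroError) {ω ω' : Inputs k}
    (h₁ : C.stopped₁ ω = C.stopped₁ ω') (h₂ : C.stopped₂ ω = C.stopped₂ ω')
    (h₃ : ω.2.2 = ω'.2.2) : ω = ω' := by
  obtain ⟨x₁, x₂, x₃⟩ := ω
  obtain ⟨y₁, y₂, y₃⟩ := ω'
  obtain rfl : x₃ = y₃ := h₃
  obtain ⟨r₁, r₂⟩ := C.stopped_rectangle h₁ h₂
  have hx : sum (x₁, y₂, x₃) = sum (x₁, x₂, x₃) := by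
    rw [← hC.dec_eq, ← hC.dec_eq, r₁, r₂]
  have hy : sum (x₁, y₂, x₃) = sum (y₁, y₂, x₃) := by
    rw [← hC.dec_eq, ← hC.dec_eq, r₁, r₂, h₁, h₂]
  have e₂ : x₂ = y₂ := funext fun i => by
    have := congrArg Fin.val (congrFun hx i)
    simp only [sum] at this
    omega
  have e₁ : x₁ = y₁ := funext fun i => by
    have := congrArg Fin.val (congrFun hy i)
    simp only [sum] at this
    omega
  rw [e₁, e₂]

lemma le_entropyGiven_stopped {C : NetworkCode k 𝒵} (hC : C.ZeroError) {v : Fin k → Fin 4}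
    (hv : ∃ ω : Inputs k, sum ω = v) :
    ((mixed v).card : ℝ) * (Real.logb 2 3 - 1)
      ≤ entropyGiven (fun ω : Inputs k => (C.stopped₁ ω, C.stopped₂ ω)) (fun ω => sum ω) v := by
  classical
  have hlog : ((mixed v).card : ℝ) * (Real.logb 2 3 - 1)
      = -Real.logb 2 (2 ^ (mixed v).card / 3 ^ (mixed v).card) := by
    rw [Real.logb_div (by positivity) (by positivity), Real.logb_pow, Real.logb_pow,
      Real.logb_self_eq_one one_lt_two]
    ring
  rw [hlog]
  refine neg_logb_le_entropyGiven _ _ hv fun u => ?_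
  rw [condPr_eq_card_div, card_sum_fiber]
  push_cast
  refine div_le_div_of_nonneg_right ?_ (by positivity)
  refine mod_cast card_le_two_pow_of_injOn v _ (fun ω hω => (Finset.mem_filter.1 hω).2.2) ?_
  intro ω hω ω' hω' h₃
  have e : (C.stopped₁ ω, C.stopped₂ ω) = (C.stopped₁ ω', C.stopped₂ ω') :=
    (Finset.mem_filter.1 hω).2.1.trans (Finset.mem_filter.1 hω').2.1.symm
  exact stopped_injective_of_side hC (Prod.ext_iff.1 e).1 (Prod.ext_iff.1 e).2 h₃

/-- The entropy bound, valid at every block length. -/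
lemma le_descriptionEntropy {C : NetworkCode k 𝒵} (hC : C.ZeroError) :
    (0.75 : ℝ) * (Real.logb 2 3 - 1) * (k : ℝ) ≤ C.descriptionEntropy := by
  classical
  have hmean := sum_pr_mul_eq (fun ω : Inputs k => sum ω)
    fun v => ((mixed v).card : ℝ) * (Real.logb 2 3 - 1)
  rw [← Finset.sum_mul, mul_div_right_comm, sum_card_mixed, mul_right_comm] at hmean
  rw [← hmean]
  unfold descriptionEntropy condEntropy
  have key : ∀ v ∈ Finset.univ.image fun ω : Inputs k => sum ω,
      pr (fun ω : Inputs k => sum ω = v) * (((mixed v).card : ℝ) * (Real.logb 2 3 - 1))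
        ≤ pr (fun ω : Inputs k => sum ω = v) * entropyGiven
          (fun ω : Inputs k => (C.stopped₁ ω, C.stopped₂ ω)) (fun ω => sum ω) v := by
    intro v hv
    obtain ⟨ω, -, hω⟩ := Finset.mem_image.1 hv
    refine mul_le_mul_of_nonneg_left (le_entropyGiven_stopped hC ⟨ω, hω⟩) ?_
    rw [pr_eq_card_div]
    positivity
  refine (Finset.sum_le_sum key).trans_eq ?_
  congr!

end NetworkCode

end ArithSum

theorem mainTheorem4 :
    (∃ K : ℕ, ∀ k : ℕ, K ≤ k → ∀ (𝒵 : Type*) [Fintype 𝒵], 1 < Fintype.card 𝒵 →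
      ∀ C : ArithSum.NetworkCode k 𝒵, C.ZeroError →
        (0.75 : ℝ) * (Real.logb 2 3 - 1) * (k : ℝ) ≤ C.descriptionEntropy) ∧
    (∀ (𝒵 : Type*) [Fintype 𝒵], 1 < Fintype.card 𝒵 →
      ∀ C : (k : ℕ) → ArithSum.NetworkCode k 𝒵, (∀ k, (C k).ZeroError) →
        (((0.75 : ℝ) * (Real.logb 2 3 - 1) : ℝ) : EReal) ≤
          Filter.liminf (fun k : ℕ => (((C k).descriptionEntropy / (k : ℝ) : ℝ) : EReal))
            Filter.atTop) := by
  refine ⟨⟨0, fun k _ 𝒵 _ _ C hC => C.le_descriptionEntropy hC⟩, fun 𝒵 _ _ C hC => ?_⟩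
  refine Filter.le_liminf_of_le (by isBoundedDefault) ?_
  filter_upwards [Filter.eventually_gt_atTop 0] with k hk
  have hk' : (0 : ℝ) < k := by exact_mod_cast hk
  exact EReal.coe_le_coe_iff.2 ((le_div_iff₀ hk').2 (ArithSum.NetworkCode.le_descriptionEntropy (hC k)))
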